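/- Let $\delta\in(0,1)$. There is a constant $C>0$, depending only on $\delta$, such that the following holds for all $d\in\mathbb N$, $R,B\in\mathbb R$ and $\varepsilon>0$. Let $\mathcal X_d\subseteq[-R,R]^d$ be compact, and let $k_d:\mathbb R^d\times\mathbb R^d\to\mathbb R$ be a continuous shift-invariant kernel (symmetric, positive semi-definite, $k_d(x+\xi,x'+\xi)=k_d(x,x')$; write $k_d(\Delta)=k_d(\Delta,0)$) with $k_d(0)=1$, whose second partial derivatives $\partial_i^2k_d(0)$ exist and satisfy $|\partial_i^2k_d(0)|\le B$ for $i=1,\dots,d$. Then there is exactly one probability measure $p_d$ on $\mathbb R^d$ with $k_d(\Delta)=\int e^{i\langle\omega,\Delta\rangle}\,\mathrm dp_d(\omega)$ (the inverse Fourier transform of $k_d$). Moreover, for every even integer $D\ge2$ with $$D\;\ge\; C\,\frac{d}{\varepsilon^2}\,\log\max\Big\{2,\frac{Rd\sqrt B}{\varepsilon}\Big\},$$ draw $\omega_1,\dots,\omega_{D/2}$ independently from $p_d$ and let $$z(x)=\sqrt{2/D}\,\big(\cos\langle\omega_1,x\rangle,\sin\langle\omega_1,x\rangle,\dots,\cos\langle\omega_{D/2},x\rangle,\sin\langle\omega_{D/2},x\rangle\big)\in\mathbb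 R^D$$ be the random Fourier feature map. Put $n=\lceil\log_4(D+1)\rceil$ and $g(x)=\|z(x)\|_1$, let $P_1,\dots,P_{4^n-1}$ be the non-identity Pauli words on $n$ qubits, let $r(x)=z(x)/g(x)$, padded with zeros to length $4^n-1$, and let $\rho(x)$ be the state obtained by preparing $2^{-n}(\mathbb I+\operatorname{sign}(r_i(x))P_i)$ with probability $|r_i(x)|$, i.e. $\rho(x)=\sum_i|r_i(x)|\,2^{-n}(\mathbb I+\operatorname{sign}(r_i(x))P_i)$. Then: 1. with probability at least $1-\delta$, for all $x,x'\in\mathcal X_d$ both $|\langle z(x),z(x')\rangle-k_d(x-x')|<\varepsilon$ and $\big|g(x)g(x')\big(2^n\operatorname{Tr}\{\rho(x)\rho(x')\}-1\big)-k_d(x-x')\big|<\varepsilon$; 2. $\rho(x)$ is a density operator on $n$ qubits for every $x\in\mathbb R^d$ and every choice of the $\omega_i$, so that $\operatorname{Tr}\{\rho(x)\rho(x')\}$ is an embedding quantum kernel; 3. $n\le 2\log D$. In particular, for any constant success probability, random Fourier features $\varepsilon$-approximate $k_d$ as an explicit inner product of dimension $D\in\mathcal O\big(\frac{d}{\varepsilon^2}\log\frac{Rd\sqrt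 B}{\varepsilon}\big)$, and this becomes an embedding quantum kernel on $\mathcal O(\log D)$ qubits. -/

import Mathlib

open MeasureTheory Filter Topology
open scoped ComplexOrder

noncomputable section

namespace QKernel

/-- `ℝ^d` with its Euclidean inner product. -/
abbrev Vec (d : ℕ) : Type := EuclideanSpace ℝ (Fin d)

/-- A (real) kernel function: symmetric and positive semi-definite. -/
structure IsKernel {𝒳 : Type*} (k : 𝒳 → 𝒳 → ℝ) : Prop where
  symm : ∀ x x', k x x' = k x' x
  psd : ∀ (m : ℕ) (x : Fin m → 𝒳) (a : Fin m → ℝ), 0 ≤ ∑ i, ∑ j, a i * a j * k (x i) (x j)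

/-- Shift invariance. The function of one argument `Δ = x - x'` is then `fun Δ => k Δ 0`. -/
def IsShiftInvariant {d : ℕ} (k : Vec d → Vec d → ℝ) : Prop :=
  ∀ x x' ξ, k (x + ξ) (x' + ξ) = k x x'

/-- The restriction of `Δ ↦ k Δ 0` to the `i`-th coordinate axis. -/
def axisRestriction {d : ℕ} (k : Vec d → Vec d → ℝ) (i : Fin d) (t : ℝ) : ℝ :=
  k (EuclideanSpace.single i t) 0

/-- The second partial derivative `∂ᵢ² k` exists at the origin and is equal to `b`. -/
def HasSecondPartialAtZero {d : ℕ} (k : Vec d → Vec d → ℝ) (i : Fin d) (b : ℝ) : Prop :=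
  (∀ᶠ t in 𝓝 (0 : ℝ), DifferentiableAt ℝ (axisRestriction k i) t) ∧
    HasDerivAt (deriv (axisRestriction k i)) b 0

/-- `p` is a probability measure whose Fourier transform `Δ ↦ ∫ exp (i ⟨ω, Δ⟩) dp(ω)` is `k`,
that is, `p` is the inverse Fourier transform of `k`. -/
def IsInverseFT {d : ℕ} (k : Vec d → Vec d → ℝ) (p : Measure (Vec d)) : Prop :=
  IsProbabilityMeasure p ∧ ∀ Δ : Vec d, charFun p Δ = (k Δ 0 : ℂ)

/-- The random Fourier feature map in dimension `D = 2 * m` for the frequencies `ω₁, …, ωₘ`: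
`z(x) = √(2/D) (cos⟨ω₁,x⟩, sin⟨ω₁,x⟩, …, cos⟨ωₘ,x⟩, sin⟨ωₘ,x⟩)`. -/
def rff {d m : ℕ} (ω : Fin m → Vec d) (x : Vec d) : Vec (2 * m) :=
  WithLp.toLp 2 fun j =>
    √(2 / ((2 * m : ℕ) : ℝ)) *
      (if (j : ℕ) % 2 = 0 then Real.cos (inner ℝ (ω ⟨(j : ℕ) / 2, by omega⟩) x)
        else Real.sin (inner ℝ (ω ⟨(j : ℕ) / 2, by omega⟩) x))

/-- `s` is an `ε`-approximation of `k` in supremum norm on the domain `X`. -/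
def IsApproxOn {d : ℕ} (X : Set (Vec d)) (s k : Vec d → Vec d → ℝ) (ε : ℝ) : Prop :=
  ∀ x ∈ X, ∀ x' ∈ X, |s x x' - k x x'| < ε

/-- The four single-qubit Pauli matrices `𝟙, X, Y, Z`. -/
def pauli : Fin 4 → Matrix (Fin 2) (Fin 2) ℂ :=
  ![1, !![0, 1; 1, 0], !![0, -Complex.I; Complex.I, 0], !![1, 0; 0, -1]]

/-- Operators on `n` qubits; the computational basis is indexed by `Fin n → Fin 2`. -/
abbrev QubitOp (n : ℕ) : Type := Matrix (Fin n → Fin 2) (Fin n → Fin 2) ℂ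

/-- The Pauli word `pauli (s 0) ⊗ ⋯ ⊗ pauli (s (n - 1))`, by the entries of the tensor product. -/
def pauliWord {n : ℕ} (s : Fin n → Fin 4) : QubitOp n :=
  Matrix.of fun a b => ∏ q, pauli (s q) (a q) (b q)

/-- The enumeration `P₁, …, P_{4^n - 1}` of the Pauli words other than the identity: the letters
of `P_i` are the base-4 digits of `i` (and `i = 0` would be the identity). The index is shifted
by one, as `Fin` starts at zero. -/
def nonIdPauli (n : ℕ) (i : Fin (4 ^ n - 1)) : QubitOp n :=
  pauliWord (finFunctionFinEquiv.symm ⟨(i : ℕ) + 1, Nat.add_lt_of_lt_sub i.isLt⟩)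

/-- The 1-norm of a vector. -/
def oneNorm {D : ℕ} (r : Fin D → ℝ) : ℝ := ∑ j, |r j|

/-- The number of qubits `⌈log₄ (D + 1)⌉` that encodes a vector of length `D`. -/
def numQubits (D : ℕ) : ℕ := Nat.clog 4 (D + 1)

/-- Padding a vector with zeros to the length `4 ^ n - 1`. -/
def pad {D : ℕ} (n : ℕ) (r : Fin D → ℝ) (i : Fin (4 ^ n - 1)) : ℝ :=
  if h : (i : ℕ) < D then r ⟨i, h⟩ else 0

/-- The state prepared by the classical-to-quantum embedding of `r`, a unit vector in the 1-norm:
the mixture in which `(𝟙 + sign (rᵢ) Pᵢ) / 2^n` is prepared with probability `|rᵢ|`. -/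
def c2qe {D : ℕ} (r : Fin D → ℝ) : QubitOp (numQubits D) :=
  ∑ i, ((|pad (numQubits D) r i| : ℝ) : ℂ) •
    ((1 / 2 ^ numQubits D : ℂ) •
      (1 + ((SignType.sign (pad (numQubits D) r i) : ℝ) : ℂ) • nonIdPauli (numQubits D) i))

/-- Density operators on `n` qubits. -/
def IsDensity {n : ℕ} (ρ : QubitOp n) : Prop := ρ.PosSemidef ∧ ρ.trace = 1

/-- The embedding quantum kernel `Tr (ρ(x) ρ(x'))` of a data embedding `ρ`. -/
def eqk {𝒳 : Type*} {n : ℕ} (ρ : 𝒳 → QubitOp n) (x x' : 𝒳) : ℝ := ((ρ x * ρ x').trace).re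

/-- The quantum random Fourier feature map: the embedding of the 1-normalized `z(x)`. -/
def qrff {d m : ℕ} (ω : Fin m → Vec d) (x : Vec d) : QubitOp (numQubits (2 * m)) :=
  c2qe fun j => rff ω x j / oneNorm (rff ω x)

/-- The kernel evaluated from the embedding quantum kernel of `qrff`, with the prefactors
`g(x) g(x') (2^n Tr (ρ(x) ρ(x')) - 1)`, `g(x) = ‖z(x)‖₁`. -/
def qrffKernel {d m : ℕ} (ω : Fin m → Vec d) (x x' : Vec d) : ℝ :=
  oneNorm (rff ω x) * oneNorm (rff ω x') * (2 ^ numQubits (2 * m) * eqk (qrff ω) x x' - 1)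

end QKernel

end

open QKernel

/-! By the addition formula for cosine, `⟨z(x), z(x')⟩` is the empirical mean of `cos ⟨ωⱼ, x - x'⟩`
over `m = D/2` independent frequencies, and its expectation is `k(x - x')` once `p` is known to
exist. The quantum expression is exactly the same number: Pauli words are trace-orthogonal, so `2^n
Tr (ρ(x) ρ(x')) = 1 + ⟨r(x), r(x')⟩`, and the prefactors undo the normalization. Hence one classical
uniform deviation bound serves both approximations.

Existence of `p` is Bochner's theorem. A Gaussian factor makes `k` integrable, positive
semi-definiteness makes the Fourier transform of the product nonnegative, inversion turns it into a
density, and tightness allows the Gaussian to be removed. Uniqueness is injectivity of the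
characteristic function.

For the deviation, Hoeffding's inequality at each of `N^d` grid points of `[-2R, 2R]^d` is combined
with a Lipschitz estimate between grid points. The Lipschitz constants are controlled by first
moments `E |ωᵢ| ≤ √B`, which come from the second derivatives of `k` at the origin. Markov's
inequality costs `O(R d √B / (ε N))`, so `N` is taken proportional to `max 2 (R d √B / ε)`; the
union bound then costs `d log N` in the exponent, whence the size of `D`.

The states are density operators because each is a convex mixture of the states `(1 ± P) / 2^n`,
with `P` a Hermitian involution. -/

/-! ### Bochner's theorem -/

section Bochner

open scoped FourierTransform RealInnerProductSpace

/-- A bounded measurable kernel that is nonnegative on finite samples has a nonnegative integral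
against the square of any probability measure. -/
theorem integral_prod_nonneg_of_sum_nonneg {Ω : Type*} [MeasurableSpace Ω] (μ : Measure Ω)
    [IsProbabilityMeasure μ] {K : Ω × Ω → ℝ} (hK : Measurable K) {M : ℝ}
    (hM : ∀ z, |K z| ≤ M)
    (hpos : ∀ (n : ℕ) (x : Fin n → Ω), 0 ≤ ∑ i, ∑ j, K (x i, x j)) :
    0 ≤ ∫ z, K z ∂(μ.prod μ) := by
  set J := ∫ z, K z ∂(μ.prod μ) with hJ
  have hM0 : 0 ≤ M := by
    have : Nonempty Ω := μ.nonempty_of_neZero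
    obtain ⟨x⟩ := this
    exact (abs_nonneg _).trans (hM (x, x))
  -- Expectation of the double sum over `n` independent samples: `n` diagonal terms, each at most
  -- `M`, and `n² - n` off-diagonal terms, each equal to `J`. The quadratic term forces `J ≥ 0`.
  have key : ∀ n : ℕ, 0 ≤ n * M + ((n : ℝ) * n - n) * J := by
    intro n
    let P := Measure.pi (fun _ : Fin n => μ)
    have hmeas : ∀ i j : Fin n, Measurable fun x : Fin n → Ω => K (x i, x j) := fun i j =>
      hK.comp ((measurable_pi_apply i).prodMk (measurable_pi_apply j))
    have hint : ∀ i j : Fin n, Integrable (fun x : Fin n → Ω => K (x i, x j)) P := fun i j =>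
      Integrable.of_bound (hmeas i j).aestronglyMeasurable M (ae_of_all _ fun x => hM _)
    have h0 : 0 ≤ ∫ x, ∑ i, ∑ j, K (x i, x j) ∂P := integral_nonneg fun x => hpos n x
    rw [integral_finsetSum _ fun i _ => integrable_finsetSum _ fun j _ => hint i j] at h0
    simp_rw [integral_finsetSum _ fun j _ => hint _ j] at h0
    have hne : ∀ i j : Fin n, i ≠ j → ∫ x, K (x i, x j) ∂P = J := by
      intro i j hij
      have hind : ProbabilityTheory.iIndepFun (fun (i : Fin n) (x : Fin n → Ω) => x i) P :=
        ProbabilityTheory.iIndepFun_pi (X := fun _ => id) (fun _ => aemeasurable_id)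
      have h2 := (ProbabilityTheory.indepFun_iff_map_prod_eq_prod_map_map
        (measurable_pi_apply i).aemeasurable (measurable_pi_apply j).aemeasurable).1
          (hind.indepFun hij)
      have hi : ∀ i : Fin n, P.map (fun x => x i) = μ := fun i =>
        (measurePreserving_eval (fun _ : Fin n => μ) i).map_eq
      rw [hi, hi] at h2
      rw [hJ, ← h2, integral_map
        ((measurable_pi_apply i).prodMk (measurable_pi_apply j)).aemeasurable
        hK.aestronglyMeasurable]
    have hle : ∀ i j : Fin n, ∫ x, K (x i, x j) ∂P ≤ J + if i = j then M - J else 0 := by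
      intro i j
      split_ifs with h
      · subst h
        calc _ ≤ ∫ _, M ∂P := integral_mono (hint i i) (integrable_const _)
                fun x => (le_abs_self _).trans (hM _)
          _ = _ := by simp
      · simp [hne i j h]
    have := h0.trans (Finset.sum_le_sum fun i _ => Finset.sum_le_sum fun j _ => hle i j)
    simp [Finset.sum_add_distrib] at this
    linarith
  by_contra! hneg
  obtain ⟨n, hn⟩ := exists_nat_gt (M / (-J) + 1)
  have h1 : M < (n - 1) * (-J) := by
    rw [← div_lt_iff₀ (by linarith)]; linarith
  have hn0 : 0 < (n : ℝ) := by
    have : 0 ≤ M / (-J) := div_nonneg hM0 (by linarith)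
    linarith
  have := key n
  nlinarith

/-- A real positive semi-definite function, i.e. the profile of a shift-invariant kernel. -/
structure IsPosSemidefFun {V : Type*} [AddGroup V] (φ : V → ℝ) : Prop where
  even : ∀ x, φ (-x) = φ x
  psd : ∀ (n : ℕ) (x : Fin n → V) (a : Fin n → ℝ), 0 ≤ ∑ i, ∑ j, a i * a j * φ (x i - x j)

namespace IsPosSemidefFun

/-- The points `x, 0` with weights `(1, ±1)` give `2 ± 2 φ(x) ≥ 0`. -/
theorem abs_le_one {V : Type*} [AddGroup V] {φ : V → ℝ} (h : IsPosSemidefFun φ) (h0 : φ 0 = 1)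
    (x : V) : |φ x| ≤ 1 := by
  have h1 := h.psd 2 ![x, 0] ![1, 1]
  have h2 := h.psd 2 ![x, 0] ![1, -1]
  simp [Fin.sum_univ_two, h0, h.even] at h1 h2
  rw [abs_le]
  constructor <;> linarith

/-- The cosine of a difference splits into cos·cos + sin·sin, so the sum consists of two quadratic
forms of `φ`. -/
theorem sum_mul_cos_nonneg {V : Type*} [NormedAddCommGroup V]
    [InnerProductSpace ℝ V] {φ : V → ℝ} (h : IsPosSemidefFun φ) (w : V) (n : ℕ) (x : Fin n → V) :
    0 ≤ ∑ i, ∑ j, φ (x i - x j) * Real.cos ⟪x i - x j, w⟫ := by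
  have h1 := h.psd n x fun i => Real.cos ⟪x i, w⟫
  have h2 := h.psd n x fun i => Real.sin ⟪x i, w⟫
  refine (add_nonneg h1 h2).trans_eq ?_
  rw [← Finset.sum_add_distrib]
  refine Finset.sum_congr rfl fun i _ => ?_
  rw [← Finset.sum_add_distrib]
  refine Finset.sum_congr rfl fun j _ => ?_
  rw [inner_sub_left, Real.cos_sub]
  ring

end IsPosSemidefFun

variable {V : Type*} [NormedAddCommGroup V] [InnerProductSpace ℝ V] [FiniteDimensional ℝ V]
  [MeasurableSpace V] [BorelSpace V]

theorem integrable_exp_neg_mul_sq_norm {b : ℝ} (hb : 0 < b) :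
    Integrable fun v : V => Real.exp (-b * ‖v‖ ^ 2) := by
  have h := (GaussianFourier.integrable_cexp_neg_mul_sq_norm_add (b := (b : ℂ))
    (by simpa using hb) 0 (0 : V)).re
  refine h.congr (ae_of_all _ fun v => ?_)
  simp only [zero_mul, add_zero]
  norm_cast

/-- Integrate `F (x - y)` against two independent centred Gaussians. The difference of the two is
again Gaussian, so integrating out `x` leaves a positive multiple of the required integral. -/
theorem integral_mul_gaussian_nonneg {F : V → ℝ} (hF : Continuous F) {M : ℝ}
    (hM : ∀ u, |F u| ≤ M)
    (hpos : ∀ (n : ℕ) (x : Fin n → V), 0 ≤ ∑ i, ∑ j, F (x i - x j)) {a : ℝ} (ha : 0 < a) :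
    0 ≤ ∫ u, Real.exp (-a * ‖u‖ ^ 2) * F u := by
  set b := 2 * a with hb
  have hb0 : 0 < b := by positivity
  set c : ℝ := ∫ v : V, Real.exp (-b * ‖v‖ ^ 2) with hc
  have hc0 : 0 < c := by
    rw [hc, GaussianFourier.integral_rexp_neg_mul_sq_norm hb0]; positivity
  set g : V → ℝ := fun v => c⁻¹ * Real.exp (-b * ‖v‖ ^ 2) with hg
  have hg0 : ∀ v, 0 ≤ g v := fun v => by positivity
  have hgc : Continuous g := by fun_prop
  have hgi : Integrable g := (integrable_exp_neg_mul_sq_norm hb0).const_mul _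
  let μ : Measure V := volume.withDensity fun v => ENNReal.ofReal (g v)
  have hμ : IsProbabilityMeasure μ := ⟨by
    rw [withDensity_apply _ MeasurableSet.univ, Measure.restrict_univ,
      ← ofReal_integral_eq_lintegral_ofReal hgi (ae_of_all _ hg0), hg, integral_const_mul,
      inv_mul_cancel₀ hc0.ne', ENNReal.ofReal_one]⟩
  have hint : ∀ h : V → ℝ, ∫ x, h x ∂μ = ∫ x, g x * h x := by
    intro h
    rw [integral_withDensity_eq_integral_toReal_smul (by fun_prop) (ae_of_all _ fun _ => by simp)]
    simp [hg0]
  have h1 := integral_prod_nonneg_of_sum_nonneg μ (K := fun z => F (z.1 - z.2))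
    (by fun_prop) (fun z => hM _) hpos
  rw [integral_prod _ (Integrable.of_bound (by fun_prop) M (ae_of_all _ fun x => hM _)), hint] at h1
  simp_rw [hint] at h1
  have h2 : ∀ x, ∫ y, g y * F (x - y) = ∫ u, g (x - u) * F u := by
    intro x
    rw [← integral_sub_left_eq_self (fun u => g (x - u) * F u) volume x]
    simp
  simp_rw [h2, ← integral_const_mul] at h1
  -- Completing the square around `u / 2`; the choice `b = 2a` leaves exactly the exponent `-a
  -- ‖u‖²`.
  have hexp : ∀ x u : V, g x * g (x - u) =
      c⁻¹ * c⁻¹ * Real.exp (-a * ‖u‖ ^ 2) * Real.exp (-(2 * b) * ‖x - (2⁻¹ : ℝ) • u‖ ^ 2) := by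
    intro x u
    simp only [hg]
    rw [mul_assoc (c⁻¹ * c⁻¹), ← Real.exp_add, mul_mul_mul_comm, ← Real.exp_add]
    congr 2
    rw [norm_sub_sq_real, norm_sub_sq_real, inner_smul_right, norm_smul]
    simp only [norm_inv, Real.norm_ofNat, hb]
    ring
  rw [integral_integral_swap] at h1
  · have h3 : ∀ u : V, ∫ x, g x * (g (x - u) * F u) =
        (c⁻¹ * c⁻¹ * ∫ x : V, Real.exp (-(2 * b) * ‖x‖ ^ 2)) * (Real.exp (-a * ‖u‖ ^ 2) * F u) := by
      intro u
      simp_rw [← mul_assoc, hexp]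
      rw [integral_mul_const, integral_const_mul,
        integral_sub_right_eq_self (fun x => Real.exp (-(2 * b) * ‖x‖ ^ 2))]
      ring
    simp_rw [h3] at h1
    rw [integral_const_mul] at h1
    refine nonneg_of_mul_nonneg_right h1 ?_
    rw [GaussianFourier.integral_rexp_neg_mul_sq_norm (by positivity)]
    positivity
  -- Integrable majorant for Fubini: `‖u‖² ≤ 2‖x‖² + 2‖x - u‖²` trades the dependence on `x - u` for
  -- a product of Gaussians in `x` and `u`.
  · have hd : Integrable (fun z : V × V => (c⁻¹ * c⁻¹ * M) *
        (Real.exp (-(b/2) * ‖z.1‖ ^ 2) * Real.exp (-(b/4) * ‖z.2‖ ^ 2)))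
        (volume.prod volume) :=
      ((integrable_exp_neg_mul_sq_norm (by positivity)).mul_prod
        (integrable_exp_neg_mul_sq_norm (by positivity))).const_mul _
    refine hd.mono' (by
      apply Continuous.aestronglyMeasurable
      simp only [Function.uncurry_def]
      fun_prop) (ae_of_all _ fun z => ?_)
    obtain ⟨x, u⟩ := z
    simp only [Function.uncurry_apply_pair, Real.norm_eq_abs, abs_mul, abs_of_nonneg (hg0 _)]
    have hM0 : 0 ≤ M := (abs_nonneg _).trans (hM u)
    have e : g x * g (x - u) ≤ c⁻¹ * c⁻¹ *
        (Real.exp (-(b/2) * ‖x‖ ^ 2) * Real.exp (-(b/4) * ‖u‖ ^ 2)) := by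
      simp only [hg]
      rw [mul_mul_mul_comm, ← Real.exp_add, ← Real.exp_add]
      refine mul_le_mul_of_nonneg_left (Real.exp_le_exp.2 ?_) (by positivity)
      have h5 : ‖u‖ ≤ ‖x‖ + ‖x - u‖ := by
        have := norm_sub_le x (x - u); simpa using this
      have h6 : ‖u‖ ^ 2 ≤ 2 * ‖x‖ ^ 2 + 2 * ‖x - u‖ ^ 2 := by
        nlinarith [norm_nonneg u, norm_nonneg x, norm_nonneg (x - u),
          sq_nonneg (‖x‖ - ‖x - u‖)]
      nlinarith [sq_nonneg ‖x - u‖]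
    calc g x * (g (x - u) * |F u|) = g x * g (x - u) * |F u| := by ring
      _ ≤ (c⁻¹ * c⁻¹ *
        (Real.exp (-(b/2) * ‖x‖ ^ 2) * Real.exp (-(b/4) * ‖u‖ ^ 2))) * M := by
          gcongr
          exact hM u
      _ = _ := by ring

namespace IsPosSemidefFun

variable {φ : V → ℝ}

theorem fourier_mul_gaussian_nonneg (h : IsPosSemidefFun φ) (hc : Continuous φ) (h0 : φ 0 = 1)
    {a : ℝ} (ha : 0 < a) (w : V) :
    0 ≤ 𝓕 (fun u : V => ((Real.exp (-a * ‖u‖ ^ 2) * φ u : ℝ) : ℂ)) w := by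
  have hi : Integrable fun u : V => Real.exp (-a * ‖u‖ ^ 2) * φ u :=
    (integrable_exp_neg_mul_sq_norm ha).mul_bdd (c := 1) hc.aestronglyMeasurable
      (ae_of_all _ fun u => h.abs_le_one h0 u)
  have hci : Integrable fun u : V => Complex.exp (↑(-2 * Real.pi * ⟪u, w⟫) * Complex.I) •
      ((Real.exp (-a * ‖u‖ ^ 2) * φ u : ℝ) : ℂ) := by
    refine hi.ofReal.bdd_mul (c := 1) ?_ (ae_of_all _ fun u => ?_)
    · exact Continuous.aestronglyMeasurable (by fun_prop)
    · rw [Complex.norm_exp_ofReal_mul_I]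
  rw [Real.fourier_eq', Complex.nonneg_iff]
  constructor
  · have hre := integral_re hci
    simp only [RCLike.re_eq_complex_re] at hre
    rw [← hre]
    have := integral_mul_gaussian_nonneg
      (F := fun u => φ u * Real.cos ⟪u, (2 * Real.pi) • w⟫) (by fun_prop) (M := 1)
      (fun u => by
        rw [abs_mul]
        exact mul_le_one₀ (h.abs_le_one h0 u) (abs_nonneg _) (Real.abs_cos_le_one _))
      (fun n x => h.sum_mul_cos_nonneg _ n x) ha
    refine this.trans_eq (integral_congr_ae (ae_of_all _ fun u => ?_))
    simp only [smul_eq_mul, Complex.re_mul_ofReal, Complex.exp_ofReal_mul_I_re, inner_smul_right]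
    rw [show -2 * Real.pi * ⟪u, w⟫ = -(2 * Real.pi * ⟪u, w⟫) by ring, Real.cos_neg]
    ring
  · have him := integral_im hci
    simp only [RCLike.im_eq_complex_im] at him
    rw [← him]
    -- `φ` is even and sine is odd, so the imaginary part of the integrand is odd and integrates to
    -- zero.
    have hodd := integral_neg_eq_self (fun u : V =>
      (Complex.exp (↑(-2 * Real.pi * ⟪u, w⟫) * Complex.I) •
        ((Real.exp (-a * ‖u‖ ^ 2) * φ u : ℝ) : ℂ)).im) volume
    simp only [smul_eq_mul, Complex.im_mul_ofReal, Complex.exp_ofReal_mul_I_im, inner_neg_left,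
      norm_neg, h.even, mul_neg, Real.sin_neg, neg_mul, integral_neg] at hodd ⊢
    linarith

end IsPosSemidefFun

/-- An integrable function with nonnegative Fourier transform that is continuous at the origin has
an integrable Fourier transform. -/
theorem MeasureTheory.Integrable.fourier_of_nonneg {f : V → ℂ}
    (hf : Integrable f) (hf0 : ContinuousAt f 0) (hpos : ∀ w, 0 ≤ 𝓕 f w) :
    Integrable (𝓕 f) := by
  have hcont : Continuous (𝓕 f) :=
    VectorFourier.fourierIntegral_continuous Real.continuous_fourierChar
      (L := innerₗ V) continuous_inner hf
  set G : V → ℝ := fun w => (𝓕 f w).re with hG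
  have hG0 : ∀ w, 0 ≤ G w := fun w => (Complex.nonneg_iff.1 (hpos w)).1
  have hGeq : ∀ w, 𝓕 f w = (G w : ℂ) := fun w =>
    Complex.ext rfl (by simpa using (Complex.nonneg_iff.1 (hpos w)).2.symm)
  have hGc : Continuous G := Complex.continuous_re.comp hcont
  have hbd : ∀ w, ‖G w‖ ≤ ∫ v, ‖f v‖ := fun w =>
    (Complex.abs_re_le_norm _).trans
      (VectorFourier.norm_fourierIntegral_le_integral_norm _ _ (innerₗ V) f w)
  have hi : ∀ n : ℕ, Integrable fun w : V => Real.exp (-(n + 1 : ℝ)⁻¹ * ‖w‖ ^ 2) * G w := fun n =>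
    (integrable_exp_neg_mul_sq_norm (by positivity)).mul_bdd hGc.aestronglyMeasurable
      (ae_of_all _ hbd)
  -- Gaussian summation of the inversion formula at the origin: the Fourier transform is moved from
  -- `f` to the Gaussian, whose transform is an approximate identity.
  have hlim : Tendsto (fun n : ℕ => ∫ w : V, Real.exp (-(n + 1 : ℝ)⁻¹ * ‖w‖ ^ 2) * G w) atTop
      (𝓝 (f 0).re) := by
    have h1 := (Real.tendsto_integral_gaussian_smul' hf hf0).comp
      (tendsto_natCast_atTop_atTop.atTop_add (tendsto_const_nhds (x := (1 : ℝ))))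
    have h2 := (Complex.continuous_re.tendsto _).comp h1
    refine h2.congr fun n => ?_
    have J : Integrable (fun w : V => Complex.exp (-((n + 1 : ℝ) : ℂ)⁻¹ * ‖w‖ ^ 2)) := by
      refine (integrable_exp_neg_mul_sq_norm (V := V)
        (b := (n + 1 : ℝ)⁻¹) (by positivity)).ofReal.congr (ae_of_all _ fun w => ?_)
      simp
    have h3 := VectorFourier.integral_fourierIntegral_smul_eq_flip (L := innerₗ V)
      Real.continuous_fourierChar continuous_inner J hf
    have h4 : ∀ w : V, VectorFourier.fourierIntegral Real.fourierChar volume (innerₗ V).flip f w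
        = G w := fun w => by
      rw [← hGeq, flip_innerₗ]; rfl
    simp_rw [h4] at h3
    simp only [Function.comp_apply]
    rw [← Complex.ofReal_re (∫ w : V, Real.exp (-(n + 1 : ℝ)⁻¹ * ‖w‖ ^ 2) * G w),
      ← integral_complex_ofReal]
    congr 1
    refine Eq.trans (integral_congr_ae (ae_of_all _ fun w => ?_)) (h3.trans
      (integral_congr_ae (ae_of_all _ fun w => ?_)))
    · change _ = 𝓕 (fun w : V => Complex.exp (-((n + 1 : ℝ) : ℂ)⁻¹ * ‖w‖ ^ 2)) w • f w
      have hre : 0 < (((n + 1 : ℝ) : ℂ)⁻¹).re := by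
        rw [← Complex.ofReal_inv, Complex.ofReal_re]; positivity
      rw [fourier_gaussian_innerProductSpace hre]
      simp only [div_inv_eq_mul, zero_sub, norm_neg]
      congr 3
      ring
    · simp
  -- Fatou's lemma as the Gaussian factor tends to 1; nonnegativity of `G` is what allows it.
  have hfat : ∫⁻ w, ENNReal.ofReal (G w) ≤ ENNReal.ofReal (f 0).re := by
    have hl := lintegral_liminf_le (μ := (volume : Measure V)) (u := atTop)
      (f := fun (n : ℕ) (w : V) => ENNReal.ofReal (Real.exp (-(n + 1 : ℝ)⁻¹ * ‖w‖ ^ 2) * G w))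
      (fun n => by fun_prop)
    have hpt : ∀ w : V, liminf (fun n : ℕ =>
        ENNReal.ofReal (Real.exp (-(n + 1 : ℝ)⁻¹ * ‖w‖ ^ 2) * G w)) atTop
        = ENNReal.ofReal (G w) := by
      intro w
      apply Tendsto.liminf_eq
      refine ENNReal.tendsto_ofReal ?_
      have : Tendsto (fun n : ℕ => (n + 1 : ℝ)⁻¹) atTop (𝓝 0) :=
        (tendsto_one_div_add_atTop_nhds_zero_nat (𝕜 := ℝ)).congr fun n => by simp
      have h5 := ((Real.continuous_exp.tendsto _).comp (this.neg.mul_const (‖w‖ ^ 2))).mul_const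
        (G w)
      simpa using h5
    simp_rw [hpt] at hl
    refine hl.trans_eq ?_
    apply Tendsto.liminf_eq
    refine (ENNReal.tendsto_ofReal hlim).congr fun n => ?_
    exact ofReal_integral_eq_lintegral_ofReal (hi n)
      (ae_of_all _ fun w => mul_nonneg (Real.exp_pos _).le (hG0 w))
  have hGi : Integrable G := by
    refine ⟨hGc.aestronglyMeasurable, ?_⟩
    rw [hasFiniteIntegral_iff_ofReal (ae_of_all _ hG0)]
    exact hfat.trans_lt ENNReal.ofReal_lt_top
  exact hGi.ofReal.congr (ae_of_all _ fun w => (hGeq w).symm)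

namespace IsPosSemidefFun

variable {φ : V → ℝ}

/-- By Fourier inversion the nonnegative, integrable transform is a density; its total mass is the
value 1 of the product at the origin. -/
theorem exists_charFun_eq_mul_gaussian (h : IsPosSemidefFun φ) (hc : Continuous φ) (h0 : φ 0 = 1)
    {a : ℝ} (ha : 0 < a) :
    ∃ μ : ProbabilityMeasure V, ∀ t : V,
      charFun (μ : Measure V) t = ((Real.exp (-a * ‖t‖ ^ 2) * φ t : ℝ) : ℂ) := by
  set f : V → ℂ := fun u => ((Real.exp (-a * ‖u‖ ^ 2) * φ u : ℝ) : ℂ) with hf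
  have hfc : Continuous f := by fun_prop
  have hfi : Integrable f := ((integrable_exp_neg_mul_sq_norm ha).mul_bdd (c := 1)
      hc.aestronglyMeasurable (ae_of_all _ fun u => h.abs_le_one h0 u)).ofReal
  have hpos : ∀ w, 0 ≤ 𝓕 f w := fun w => h.fourier_mul_gaussian_nonneg hc h0 ha w
  have hFi : Integrable (𝓕 f) := hfi.fourier_of_nonneg hfc.continuousAt hpos
  have hcont : Continuous (𝓕 f) :=
    VectorFourier.fourierIntegral_continuous Real.continuous_fourierChar
      (L := innerₗ V) continuous_inner hfi
  have hinv := hfc.fourierInv_fourier_eq hfi hFi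
  set G : V → ℝ := fun w => (𝓕 f w).re with hG
  have hG0 : ∀ w, 0 ≤ G w := fun w => (Complex.nonneg_iff.1 (hpos w)).1
  have hGeq : ∀ w, 𝓕 f w = (G w : ℂ) := fun w =>
    Complex.ext rfl (by simpa using (Complex.nonneg_iff.1 (hpos w)).2.symm)
  have hGc : Continuous G := Complex.continuous_re.comp hcont
  have hGi : Integrable G := hFi.re
  let ν : Measure V := volume.withDensity fun w => ENNReal.ofReal (G w)
  -- The Fourier transform has `2π` in its exponent and `charFun` does not; the rescaled image of
  -- `ν` below absorbs the factor.
  have hν : ∀ t, charFun ν ((2 * Real.pi) • t) = f t := by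
    intro t
    rw [← congrFun hinv t, Real.fourierInv_eq', charFun_apply,
      integral_withDensity_eq_integral_toReal_smul (by fun_prop) (ae_of_all _ fun _ => by simp)]
    refine integral_congr_ae (ae_of_all _ fun w => ?_)
    simp only [hGeq, ENNReal.toReal_ofReal (hG0 w), inner_smul_right, smul_eq_mul,
      Complex.real_smul]
    rw [mul_comm]
  have hνfin : IsFiniteMeasure ν := isFiniteMeasure_withDensity_ofReal hGi.2
  have hν1 : ν.real Set.univ = 1 := by
    have := hν 0
    rw [smul_zero, charFun_zero] at this
    simpa [hf, h0] using this
  have hνp : IsProbabilityMeasure ν := ⟨by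
    rw [← ENNReal.ofReal_toReal (measure_ne_top ν Set.univ)]
    change ENNReal.ofReal (ν.real Set.univ) = 1
    simp [hν1]⟩
  refine ⟨⟨ν.map (fun w => (2 * Real.pi) • w), Measure.isProbabilityMeasure_map (by fun_prop)⟩,
    fun t => ?_⟩
  change charFun (ν.map (fun w => (2 * Real.pi) • w)) t = f t
  rw [charFun_map_smul, hν]

/-- **Bochner's theorem** for real functions on a finite-dimensional inner product space. -/
theorem exists_charFun_eq (h : IsPosSemidefFun φ) (hc : Continuous φ) (h0 : φ 0 = 1) :
    ∃ μ : ProbabilityMeasure V, ∀ t : V, charFun (μ : Measure V) t = φ t := by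
  choose μ hμ using fun n : ℕ => h.exists_charFun_eq_mul_gaussian hc h0
    (inv_pos.2 n.cast_add_one_pos : 0 < ((n : ℝ) + 1)⁻¹)
  have hlim : ∀ t, Tendsto (fun n => charFun (μ n : Measure V) t) atTop (𝓝 (φ t : ℂ)) := by
    intro t
    simp_rw [hμ]
    refine (Complex.continuous_ofReal.tendsto _).comp ?_
    have : Tendsto (fun n : ℕ => (n + 1 : ℝ)⁻¹) atTop (𝓝 0) :=
      (tendsto_one_div_add_atTop_nhds_zero_nat (𝕜 := ℝ)).congr fun n => by simp
    have h5 := ((Real.continuous_exp.tendsto _).comp (this.neg.mul_const (‖t‖ ^ 2))).mul_const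
      (φ t)
    simpa using h5
  -- Pointwise convergence of characteristic functions to a continuous limit gives tightness. By
  -- Prokhorov's theorem there is a cluster point, which suffices because the characteristic
  -- functions themselves converge.
  have htight := isTightMeasureSet_of_tendsto_charFun (μ := fun n => (μ n : Measure V))
    (f := fun t => (φ t : ℂ)) (by fun_prop) hlim
  have hcomp : IsCompact (closure (Set.range μ)) :=
    isCompact_closure_of_isTightMeasureSet (by
      convert htight using 1
      ext; simp)
  obtain ⟨ν, -, hν⟩ := hcomp.exists_mapClusterPt (u := μ) (f := atTop)
    (tendsto_principal.2 (Eventually.of_forall fun n => subset_closure (Set.mem_range_self n)))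
  refine ⟨ν, fun t => ?_⟩
  have hcl : MapClusterPt (charFun (ν : Measure V) t) atTop
      (fun n => charFun (μ n : Measure V) t) := by
    have hct : Continuous fun ρ : ProbabilityMeasure V => charFun (ρ : Measure V) t := by
      simp_rw [charFun_eq_integral_innerProbChar]
      refine continuous_iff_continuousAt.2 fun ρ => ?_
      exact (ProbabilityMeasure.tendsto_iff_forall_integral_rclike_tendsto ℂ).1 tendsto_id _
    exact MapClusterPt.continuousAt_comp hct.continuousAt hν
  exact eq_of_nhds_neBot (ClusterPt.mono hcl (hlim t))

end IsPosSemidefFun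

end Bochner

namespace QKernel

/-! ### Moments of the frequencies from second derivatives at the origin -/

section Moments

/-- Second-order Taylor expansion with Peano remainder at a local maximum. -/
theorem tendsto_sub_div_sq_of_hasDerivAt_deriv {h : ℝ → ℝ} {b : ℝ}
    (hd : ∀ᶠ t in 𝓝 (0 : ℝ), DifferentiableAt ℝ h t) (h2 : HasDerivAt (deriv h) b 0)
    (hmax : IsLocalMax h 0) :
    Tendsto (fun t => (h t - h 0) / t ^ 2) (𝓝[≠] 0) (𝓝 (b / 2)) := by
  have h0 : deriv h 0 = 0 := hmax.deriv_eq_zero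
  have hc : ContinuousAt h 0 := hd.self_of_nhds.continuousAt
  -- L'Hôpital is applied once only, as the second derivative is known only at 0. Since `h'(0) = 0`,
  -- the quotient `h'(t) / (2t)` is half a difference quotient of `h'`.
  refine HasDerivAt.lhopital_zero_nhdsNE (f' := deriv h) (g' := fun t => 2 * t) ?_ ?_ ?_ ?_ ?_ ?_
  · filter_upwards [nhdsWithin_le_nhds hd] with t ht
    exact ht.hasDerivAt.sub_const _
  · exact Eventually.of_forall fun t => by simpa using hasDerivAt_pow 2 t
  · filter_upwards [self_mem_nhdsWithin] with t ht
    exact mul_ne_zero two_ne_zero ht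
  · have : Tendsto (fun t => h t - h 0) (𝓝 0) (𝓝 (h 0 - h 0)) := hc.tendsto.sub_const _
    rw [sub_self] at this
    exact this.mono_left nhdsWithin_le_nhds
  · have : Tendsto (fun t : ℝ => t ^ 2) (𝓝 0) (𝓝 (0 ^ 2)) := (continuous_pow 2).tendsto 0
    rw [zero_pow two_ne_zero] at this
    exact this.mono_left nhdsWithin_le_nhds
  · have := (hasDerivAt_iff_tendsto_slope_zero.1 h2).div_const 2
    refine this.congr fun t => ?_
    simp only [zero_add, h0, sub_zero, smul_eq_mul]
    rw [div_eq_mul_inv, div_eq_mul_inv, mul_inv]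
    ring

/-- `2 (1 - cos (s x)) = (2 sin (s x / 2))²`, so the quotient is the square of a difference
quotient. -/
theorem tendsto_one_sub_cos_div_sq (x : ℝ) :
    Tendsto (fun s : ℝ => 2 * (1 - Real.cos (s * x)) / s ^ 2) (𝓝[≠] 0) (𝓝 (x ^ 2)) := by
  have h1 : HasDerivAt (fun s : ℝ => Real.sin (s * (x / 2))) (x / 2) 0 := by
    simpa using ((hasDerivAt_id (0 : ℝ)).mul_const (x / 2)).sin
  have h2 := ((hasDerivAt_iff_tendsto_slope_zero.1 h1).const_mul 2).pow 2
  have e : (2 * (x / 2)) ^ 2 = x ^ 2 := by ring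
  rw [e] at h2
  refine h2.congr fun s => ?_
  have hcos : Real.cos (s * x) = 1 - 2 * Real.sin (s * (x / 2)) ^ 2 := by
    rw [show s * x = 2 * (s * (x / 2)) by ring, Real.cos_two_mul, Real.cos_sq']
    ring
  simp only [zero_add, zero_mul, Real.sin_zero, sub_zero, smul_eq_mul, hcos]
  rw [mul_pow, mul_pow, inv_pow]
  ring

variable {d : ℕ} {k : Vec d → Vec d → ℝ} {p : Measure (Vec d)}

theorem IsInverseFT.integral_cos (hp : IsInverseFT k p) (Δ : Vec d) :
    ∫ ω, Real.cos (inner ℝ ω Δ) ∂p = k Δ 0 := by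
  have := hp.1
  have hi : Integrable (fun ω : Vec d => Complex.exp (inner ℝ ω Δ * Complex.I)) p :=
    Integrable.of_bound (Continuous.aestronglyMeasurable (by fun_prop)) 1
      (ae_of_all _ fun ω => by rw [Complex.norm_exp_ofReal_mul_I])
  have h1 := congrArg Complex.re (hp.2 Δ)
  rw [charFun_apply, Complex.ofReal_re] at h1
  have h2 := integral_re hi
  simp only [RCLike.re_eq_complex_re, Complex.exp_ofReal_mul_I_re] at h2
  rw [h2, h1]

theorem IsInverseFT.axisRestriction_eq (hp : IsInverseFT k p) (i : Fin d) (t : ℝ) :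
    axisRestriction k i t = ∫ ω, Real.cos (t * ω i) ∂p := by
  rw [axisRestriction, ← hp.integral_cos]
  simp [EuclideanSpace.inner_single_right]

/-- Fatou's lemma for `2 (1 - cos (s ωᵢ)) / s² → ωᵢ²`; the expectations are second difference
quotients of `k` along the axis and converge to `-b`. -/
theorem IsInverseFT.lintegral_sq_le (hp : IsInverseFT k p) {i : Fin d} {b : ℝ}
    (hb : HasSecondPartialAtZero k i b) :
    ∫⁻ ω, ENNReal.ofReal ((ω i) ^ 2) ∂p ≤ ENNReal.ofReal (-b) := by
  have := hp.1
  have hcosi : ∀ t : ℝ, Integrable (fun ω : Vec d => Real.cos (t * ω i)) p := fun t =>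
    Integrable.of_bound (Continuous.aestronglyMeasurable (by fun_prop)) 1
      (ae_of_all _ fun ω => Real.abs_cos_le_one _)
  have h0 : axisRestriction k i 0 = 1 := by simp [hp.axisRestriction_eq]
  have hmax : IsLocalMax (axisRestriction k i) 0 := Eventually.of_forall fun t => by
    rw [h0, hp.axisRestriction_eq]
    calc _ ≤ ∫ _, (1 : ℝ) ∂p := integral_mono (hcosi t) (integrable_const _)
            fun ω => Real.cos_le_one _
      _ = 1 := by simp
  have hlim : Tendsto (fun t => 2 * (1 - axisRestriction k i t) / t ^ 2) (𝓝[≠] 0) (𝓝 (-b)) := by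
    have := (tendsto_sub_div_sq_of_hasDerivAt_deriv hb.1 hb.2 hmax).const_mul (-2)
    rw [h0, show -2 * (b / 2) = -b by ring] at this
    exact this.congr fun t => by ring
  have hs : Tendsto (fun n : ℕ => 1 / ((n : ℝ) + 1)) atTop (𝓝[≠] 0) :=
    tendsto_nhdsWithin_iff.2 ⟨tendsto_one_div_add_atTop_nhds_zero_nat,
      Eventually.of_forall fun n => by
        simp only [Set.mem_compl_iff, Set.mem_singleton_iff]; positivity⟩
  have hl := lintegral_liminf_le (μ := p) (u := atTop)
    (f := fun (n : ℕ) (ω : Vec d) => ENNReal.ofReal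
      (2 * (1 - Real.cos (1 / ((n : ℝ) + 1) * ω i)) / (1 / ((n : ℝ) + 1)) ^ 2))
    (fun n => by fun_prop)
  have hpt : ∀ ω : Vec d, liminf (fun n : ℕ => ENNReal.ofReal
      (2 * (1 - Real.cos (1 / ((n : ℝ) + 1) * ω i)) / (1 / ((n : ℝ) + 1)) ^ 2)) atTop
      = ENNReal.ofReal ((ω i) ^ 2) := fun ω =>
    (ENNReal.tendsto_ofReal ((tendsto_one_sub_cos_div_sq (ω i)).comp hs)).liminf_eq
  simp_rw [hpt] at hl
  refine hl.trans_eq (Tendsto.liminf_eq ?_)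
  refine (ENNReal.tendsto_ofReal (hlim.comp hs)).congr fun n => ?_
  rw [← ofReal_integral_eq_lintegral_ofReal]
  · rw [integral_div, integral_const_mul, integral_sub (integrable_const _) (hcosi _)]
    simp [hp.axisRestriction_eq]
  · exact (((integrable_const _).sub (hcosi _)).const_mul _).div_const _
  · refine ae_of_all _ fun ω => ?_
    have := Real.cos_le_one (1 / ((n : ℝ) + 1) * ω i)
    exact div_nonneg (by simpa using this) (by positivity)

theorem IsInverseFT.integrable_abs_and_integral_abs_le (hp : IsInverseFT k p) {i : Fin d}
    {b B : ℝ} (hb : HasSecondPartialAtZero k i b) (hB : |b| ≤ B) :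
    Integrable (fun ω : Vec d => |ω i|) p ∧ ∫ ω, |ω i| ∂p ≤ √B := by
  have := hp.1
  have hle := (hp.lintegral_sq_le hb).trans
    (ENNReal.ofReal_le_ofReal ((neg_le_abs b).trans hB))
  have hB0 : 0 ≤ B := (abs_nonneg b).trans hB
  have hm : AEStronglyMeasurable (fun ω : Vec d => |ω i|) p :=
    Continuous.aestronglyMeasurable (by fun_prop)
  have hsq : Integrable (fun ω : Vec d => (ω i) ^ 2) p := by
    refine ⟨Continuous.aestronglyMeasurable (by fun_prop), ?_⟩
    rw [hasFiniteIntegral_iff_ofReal (ae_of_all _ fun ω => sq_nonneg _)]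
    exact hle.trans_lt ENNReal.ofReal_lt_top
  have hsq' : ∫ ω, (ω i) ^ 2 ∂p ≤ B := by
    rw [integral_eq_lintegral_of_nonneg_ae (ae_of_all _ fun ω => sq_nonneg _) hsq.1]
    exact ENNReal.toReal_le_of_le_ofReal hB0 hle
  have hL : MemLp (fun ω : Vec d => |ω i|) 2 p :=
    (memLp_two_iff_integrable_sq hm).2 (by simpa using hsq)
  refine ⟨hL.integrable one_le_two, Real.le_sqrt_of_sq_le ?_⟩
  -- Nonnegative variance of `|ωᵢ|` gives `(E |ωᵢ|)² ≤ E ωᵢ² ≤ B`.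
  have hv := ProbabilityTheory.variance_nonneg (fun ω : Vec d => |ω i|) p
  rw [ProbabilityTheory.variance_eq_sub hL] at hv
  simp only [Pi.pow_apply, sq_abs] at hv
  linarith

end Moments

/-! ### Uniform concentration of the empirical cosine average -/

section Concentration

variable {d m : ℕ} {p : Measure (Vec d)}

/-- The empirical average of `cos ⟨ωⱼ, Δ⟩` over the sampled frequencies. -/
noncomputable def cosAverage (ω : Fin m → Vec d) (Δ : Vec d) : ℝ :=
  (∑ j, Real.cos (inner ℝ (ω j) Δ)) / m

/-- The mean of `cos ⟨ω, Δ⟩` for a random frequency `ω`. -/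
noncomputable def cosMean (p : Measure (Vec d)) (Δ : Vec d) : ℝ :=
  ∫ ω, Real.cos (inner ℝ ω Δ) ∂p

open ProbabilityTheory in
-- Hoeffding's inequality, applied to the variables and to their negatives.
theorem measureReal_le_abs_cosAverage_sub_cosMean [IsProbabilityMeasure p] (hm : 0 < m)
    (Δ : Vec d) {t : ℝ} (ht : 0 ≤ t) :
    (Measure.pi fun _ : Fin m => p).real {ω | t ≤ |cosAverage ω Δ - cosMean p Δ|} ≤
      2 * Real.exp (-(m * t ^ 2 / 2)) := by
  set P := Measure.pi fun _ : Fin m => p with hP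
  have hm' : (0 : ℝ) < m := Nat.cast_pos.2 hm
  let X : Fin m → (Fin m → Vec d) → ℝ := fun j ω => Real.cos (inner ℝ (ω j) Δ) - cosMean p Δ
  have hind : iIndepFun X P :=
    iIndepFun_pi (X := fun _ (ω : Vec d) => Real.cos (inner ℝ ω Δ) - cosMean p Δ)
      fun _ => Measurable.aemeasurable (by fun_prop)
  have hmean : ∀ j : Fin m, ∫ ω, Real.cos (inner ℝ (ω j) Δ) ∂P = cosMean p Δ := fun j => by
    have hmp := measurePreserving_eval (fun _ : Fin m => p) j
    rw [cosMean, ← hmp.map_eq, integral_map hmp.measurable.aemeasurable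
      (Continuous.aestronglyMeasurable (by fun_prop))]
  -- Values in `[-1, 1]` give the sub-Gaussian parameter `((1 - (-1)) / 2)² = 1`.
  have hsub : ∀ j, HasSubgaussianMGF (X j) 1 P := fun j => by
    have h := hasSubgaussianMGF_of_mem_Icc (μ := P) (a := -1) (b := 1)
      (X := fun ω => Real.cos (inner ℝ (ω j) Δ)) (Measurable.aemeasurable (by fun_prop))
      (ae_of_all _ fun ω => Real.cos_mem_Icc _)
    rw [hmean] at h
    convert h
    rw [show (1 : ℝ) - -1 = 2 by norm_num]
    ext
    simp
  have hsum : ∀ ω : Fin m → Vec d, ∑ j, X j ω = m * (cosAverage ω Δ - cosMean p Δ) := fun ω => by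
    simp only [X, cosAverage, Finset.sum_sub_distrib, Finset.sum_const, Finset.card_univ,
      Fintype.card_fin, nsmul_eq_mul]
    field_simp
  have hexp : Real.exp (-(m * t) ^ 2 / (2 * m)) = Real.exp (-(m * t ^ 2 / 2)) := by
    congr 1; field_simp
  have h1 := HasSubgaussianMGF.measure_sum_ge_le_of_iIndepFun hind (s := Finset.univ)
    (c := fun _ => 1) (fun j _ => hsub j) (mul_nonneg hm'.le ht)
  have h2 := HasSubgaussianMGF.measure_sum_ge_le_of_iIndepFun
    (hind.comp (fun _ => Neg.neg) fun _ => measurable_neg) (s := Finset.univ)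
    (c := fun _ => 1) (fun j _ => (hsub j).neg) (mul_nonneg hm'.le ht)
  simp only [Function.comp_apply, Finset.sum_neg_distrib, hsum, NNReal.coe_natCast, Finset.sum_const,
    Finset.card_univ, Fintype.card_fin, nsmul_eq_mul, mul_one, hexp] at h1 h2
  have hsubset : {ω : Fin m → Vec d | t ≤ |cosAverage ω Δ - cosMean p Δ|} ⊆
      {ω | m * t ≤ m * (cosAverage ω Δ - cosMean p Δ)} ∪
      {ω | m * t ≤ -(m * (cosAverage ω Δ - cosMean p Δ))} := by
    intro ω (hω : t ≤ |_|)
    rcases le_abs.1 hω with h | h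
    · exact Or.inl (mul_le_mul_of_nonneg_left h hm'.le)
    · refine Or.inr ?_
      simp only [Set.mem_ofPred_eq, ← mul_neg]
      exact mul_le_mul_of_nonneg_left h hm'.le
  calc _ ≤ _ := measureReal_mono hsubset
    _ ≤ _ := measureReal_union_le _ _
    _ ≤ _ := by linarith

theorem exists_grid_point {N : ℕ} (hN : 0 < N) {L t : ℝ} (ht : t ∈ Set.Icc 0 L) :
    ∃ q : Fin N, |t - L / N * q| ≤ L / N := by
  have hN' : (0 : ℝ) < N := Nat.cast_pos.2 hN
  obtain ⟨h0, hL⟩ := ht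
  rcases (h0.trans hL).eq_or_lt with rfl | hL0
  · refine ⟨⟨0, hN⟩, ?_⟩
    simp [le_antisymm hL h0]
  rcases h0.eq_or_lt with rfl | h0
  · exact ⟨⟨0, hN⟩, by simp; positivity⟩
  have hpos : 0 < t / (L / N) := by positivity
  have hle : ⌈t / (L / N)⌉₊ ≤ N := by
    rw [Nat.ceil_le, div_le_iff₀ (by positivity)]
    field_simp
    exact hL
  have hc : 0 < ⌈t / (L / N)⌉₊ := Nat.ceil_pos.2 hpos
  -- The ceiling minus one, rather than the floor, keeps the index below `N` at the endpoint `t =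
  -- L`.
  refine ⟨⟨⌈t / (L / N)⌉₊ - 1, by omega⟩, ?_⟩
  have h1 : ((⌈t / (L / N)⌉₊ - 1 : ℕ) : ℝ) = ⌈t / (L / N)⌉₊ - 1 := by
    rw [Nat.cast_sub hc, Nat.cast_one]
  simp only [h1]
  have h2 := Nat.le_ceil (t / (L / N))
  have h3 := Nat.ceil_lt_add_one hpos.le
  have h4 : t = L / N * (t / (L / N)) := by field_simp
  have hLN : 0 < L / N := by positivity
  rw [abs_le]
  constructor <;> nlinarith

theorem abs_cos_inner_sub_le {h : ℝ} (ω : Vec d) {Δ c : Vec d} (hc : ∀ i, |Δ i - c i| ≤ h) :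
    |Real.cos (inner ℝ ω Δ) - Real.cos (inner ℝ ω c)| ≤ h * ∑ i, |ω i| := by
  refine (Real.abs_cos_sub_cos_le _ _).trans ?_
  rw [← inner_sub_right, PiLp.inner_apply, Finset.mul_sum]
  refine (Finset.abs_sum_le_sum_abs _ _).trans (Finset.sum_le_sum fun i _ => ?_)
  simp only [RCLike.inner_apply, conj_trivial, abs_mul, PiLp.sub_apply]
  exact mul_le_mul_of_nonneg_right (hc i) (abs_nonneg _)

theorem abs_cosAverage_sub_le {h : ℝ} (ω : Fin m → Vec d) {Δ c : Vec d}
    (hc : ∀ i, |Δ i - c i| ≤ h) :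
    |cosAverage ω Δ - cosAverage ω c| ≤ h * ((∑ j, ∑ i, |ω j i|) / m) := by
  rw [cosAverage, cosAverage, ← sub_div, ← Finset.sum_sub_distrib, abs_div, Nat.abs_cast,
    ← mul_div_assoc, Finset.mul_sum]
  gcongr
  exact (Finset.abs_sum_le_sum_abs _ _).trans
    (Finset.sum_le_sum fun j _ => abs_cos_inner_sub_le _ hc)

theorem abs_cosMean_sub_le [IsProbabilityMeasure p] {h s : ℝ} (h0 : 0 ≤ h) {Δ c : Vec d}
    (hc : ∀ i, |Δ i - c i| ≤ h) (hi : ∀ i, Integrable (fun ω : Vec d => |ω i|) p)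
    (hs : ∀ i, ∫ ω, |ω i| ∂p ≤ s) :
    |cosMean p Δ - cosMean p c| ≤ h * (d * s) := by
  have hcos : ∀ Δ : Vec d, Integrable (fun ω : Vec d => Real.cos (inner ℝ ω Δ)) p := fun Δ =>
    Integrable.of_bound (Continuous.aestronglyMeasurable (by fun_prop)) 1
      (ae_of_all _ fun ω => Real.abs_cos_le_one _)
  rw [cosMean, cosMean, ← integral_sub (hcos _) (hcos _)]
  calc _ ≤ ∫ ω, |Real.cos (inner ℝ ω Δ) - Real.cos (inner ℝ ω c)| ∂p :=
        abs_integral_le_integral_abs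
    _ ≤ ∫ ω, h * ∑ i, |ω i| ∂p := by
        refine integral_mono ((hcos _).sub (hcos _)).abs
          ((integrable_finsetSum _ fun i _ => hi i).const_mul _) fun ω => ?_
        exact abs_cos_inner_sub_le _ hc
    _ = h * ∑ i, ∫ ω, |ω i| ∂p := by
        rw [integral_const_mul, integral_finsetSum _ fun i _ => hi i]
    _ ≤ h * ∑ _ : Fin d, s := by gcongr; exact hs _
    _ = _ := by simp

/-- Markov's inequality: the mean is at most `2 h d s` and the threshold is `ε / 2`. The event
concerns the sum of the random and the deterministic Lipschitz errors. -/
theorem measureReal_le_average_abs [IsProbabilityMeasure p] (hm : 0 < m) {h s ε : ℝ} (h0 : 0 ≤ h)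
    (hs0 : 0 ≤ s) (hε : 0 < ε) (hi : ∀ i, Integrable (fun ω : Vec d => |ω i|) p)
    (hs : ∀ i, ∫ ω, |ω i| ∂p ≤ s) :
    (Measure.pi fun _ : Fin m => p).real
      {ω | ε / 2 ≤ h * ((∑ j, ∑ i, |ω j i|) / m) + h * (d * s)} ≤ 4 * (h * (d * s)) / ε := by
  set P := Measure.pi fun _ : Fin m => p with hP
  have hm' : (0 : ℝ) < m := Nat.cast_pos.2 hm
  have hmp := fun j => measurePreserving_eval (fun _ : Fin m => p) j
  have hij : ∀ j i, Integrable (fun ω : Fin m → Vec d => |ω j i|) P := fun j i =>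
    (hmp j).integrable_comp_of_integrable (hi i)
  have hmean : ∀ j i, ∫ ω, |ω j i| ∂P = ∫ ω, |ω i| ∂p := fun j i => by
    rw [← (hmp j).map_eq, integral_map (hmp j).measurable.aemeasurable
      (Continuous.aestronglyMeasurable (by fun_prop))]
  have hsumi : Integrable (fun ω : Fin m → Vec d => ∑ j, ∑ i, |ω j i|) P :=
    integrable_finsetSum _ fun j _ => integrable_finsetSum _ fun i _ => hij j i
  have hY : Integrable (fun ω : Fin m → Vec d =>
      h * ((∑ j, ∑ i, |ω j i|) / m) + h * (d * s)) P :=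
    ((hsumi.div_const _).const_mul _).add (integrable_const _)
  have hEY : ∫ ω, (h * ((∑ j, ∑ i, |ω j i|) / m) + h * (d * s)) ∂P ≤ 2 * (h * (d * s)) := by
    rw [integral_add ((hsumi.div_const _).const_mul _) (integrable_const _), integral_const_mul,
      integral_div, integral_finsetSum _ fun j _ => integrable_finsetSum _ fun i _ => hij j i]
    simp_rw [integral_finsetSum _ fun i _ => hij _ i, hmean]
    have h1 : ∑ _ : Fin m, ∑ i, ∫ ω, |ω i| ∂p ≤ m * (d * s) := by
      calc _ ≤ ∑ _ : Fin m, ∑ _ : Fin d, s := by gcongr; exact hs _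
        _ = _ := by simp
    have h2 : (∑ _ : Fin m, ∑ i, ∫ ω, |ω i| ∂p) / m ≤ d * s := by
      rw [div_le_iff₀ hm']; linarith
    have h3 := mul_le_mul_of_nonneg_left h2 h0
    simp only [integral_const, probReal_univ, smul_eq_mul, one_mul]
    linarith
  have hmk := mul_meas_ge_le_integral_of_nonneg (μ := P) (ae_of_all _ fun ω => by
    change 0 ≤ _
    positivity) hY (ε / 2)
  rw [le_div_iff₀ hε]
  change ε / 2 * P.real _ ≤ _ at hmk
  linarith

/-- Uniform deviation bound for random Fourier features on the cube `[-2R, 2R]^d`, by a union bound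
over a grid with `N` points per axis. -/
theorem measure_exists_le_abs_cosAverage_sub_cosMean [IsProbabilityMeasure p] (hm : 0 < m)
    {R s ε : ℝ} (hR : 0 ≤ R) (hs0 : 0 ≤ s) (hε : 0 < ε)
    (hi : ∀ i, Integrable (fun ω : Vec d => |ω i|) p) (hs : ∀ i, ∫ ω, |ω i| ∂p ≤ s)
    {N : ℕ} (hN : 0 < N) :
    (Measure.pi fun _ : Fin m => p)
      {ω | ∃ Δ : Vec d, (∀ i, |Δ i| ≤ 2 * R) ∧ ε ≤ |cosAverage ω Δ - cosMean p Δ|} ≤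
    ENNReal.ofReal ((N : ℝ) ^ d * (2 * Real.exp (-(m * ε ^ 2 / 8))) +
      16 * (R * d * s / ε) / N) := by
  set P := Measure.pi fun _ : Fin m => p with hP
  have hN' : (0 : ℝ) < N := Nat.cast_pos.2 hN
  set h : ℝ := 4 * R / N with hh
  have h0 : 0 ≤ h := by positivity
  let c : (Fin d → Fin N) → Vec d := fun q => WithLp.toLp 2 fun i => -(2 * R) + h * (q i : ℕ)
  -- If the deviation is below `ε / 2` at every grid point and both Lipschitz errors together are
  -- below `ε / 2`, the deviation is below `ε` on the whole cube.
  have hsubset : {ω : Fin m → Vec d | ∃ Δ : Vec d, (∀ i, |Δ i| ≤ 2 * R) ∧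
        ε ≤ |cosAverage ω Δ - cosMean p Δ|} ⊆
      (⋃ q, {ω | ε / 2 ≤ |cosAverage ω (c q) - cosMean p (c q)|}) ∪
      {ω | ε / 2 ≤ h * ((∑ j, ∑ i, |ω j i|) / m) + h * (d * s)} := by
    rintro ω ⟨Δ, hΔ, hdev⟩
    by_contra hcon
    simp only [Set.mem_union, Set.mem_iUnion, Set.mem_ofPred_eq, not_or, not_exists, not_le] at hcon
    have hq : ∀ i, ∃ q : Fin N, |(Δ i + 2 * R) - h * (q : ℕ)| ≤ h := fun i => by
      have := abs_le.1 (hΔ i)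
      exact exists_grid_point hN ⟨by linarith, by linarith⟩
    choose q hq using hq
    have hc : ∀ i, |Δ i - c q i| ≤ h := fun i => by
      have := hq i
      simp only [c]
      convert this using 2
      ring
    have h1 := abs_le.1 (abs_cosAverage_sub_le ω hc)
    have h2 := abs_le.1 (abs_cosMean_sub_le (p := p) h0 hc hi hs)
    have h3 := abs_lt.1 (hcon.1 q)
    have h4 := hcon.2
    rcases le_abs.1 hdev with h5 | h5 <;> linarith
  have hreal : P.real {ω : Fin m → Vec d | ∃ Δ : Vec d, (∀ i, |Δ i| ≤ 2 * R) ∧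
        ε ≤ |cosAverage ω Δ - cosMean p Δ|} ≤ (N : ℝ) ^ d * (2 * Real.exp (-(m * ε ^ 2 / 8))) +
      16 * (R * d * s / ε) / N := by
    refine (measureReal_mono hsubset).trans ((measureReal_union_le _ _).trans (add_le_add ?_ ?_))
    · refine (measureReal_iUnion_fintype_le _).trans ?_
      calc _ ≤ ∑ _ : Fin d → Fin N, 2 * Real.exp (-(m * ε ^ 2 / 8)) := by
            refine Finset.sum_le_sum fun q _ => ?_
            refine (measureReal_le_abs_cosAverage_sub_cosMean hm (c q) (by positivity)).trans_eq ?_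
            congr 3
            ring
        _ = _ := by simp
    · refine (measureReal_le_average_abs hm h0 hs0 hε hi hs).trans_eq ?_
      rw [hh]
      field_simp
      ring
  rw [← ENNReal.ofReal_toReal (measure_ne_top P _)]
  exact ENNReal.ofReal_le_ofReal hreal

end Concentration

/-! ### Pauli words and the classical-to-quantum embedding -/

section Pauli

open Matrix

theorem conjTranspose_pauli (a : Fin 4) : (pauli a)ᴴ = pauli a := by
  fin_cases a <;> ext i j <;> fin_cases i <;> fin_cases j <;> simp [pauli]

theorem pauli_mul_self (a : Fin 4) : pauli a * pauli a = 1 := by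
  fin_cases a <;> ext i j <;> fin_cases i <;> fin_cases j <;> simp [pauli, Matrix.mul_apply]

theorem trace_pauli_mul (a b : Fin 4) :
    (pauli a * pauli b).trace = if a = b then 2 else 0 := by
  split_ifs with h
  · subst h
    rw [pauli_mul_self]; simp
  · fin_cases a <;> fin_cases b <;> simp_all [pauli, Matrix.trace_fin_two]

variable {n : ℕ}

/-- The mixed-product rule for tensor products: by distributivity, the sum over intermediate indices
of a product over qubits is a product of sums. -/
theorem pauliWord_mul_apply (s t : Fin n → Fin 4) (a b : Fin n → Fin 2) :
    (pauliWord s * pauliWord t) a b = ∏ q, (pauli (s q) * pauli (t q)) (a q) (b q) := by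
  simp only [pauliWord, Matrix.mul_apply, Matrix.of_apply, ← Finset.prod_mul_distrib]
  rw [Finset.prod_univ_sum]
  simp

theorem pauliWord_mul_self (s : Fin n → Fin 4) : pauliWord s * pauliWord s = 1 := by
  ext a b
  rw [pauliWord_mul_apply]
  simp only [pauli_mul_self, Matrix.one_apply, Finset.prod_ite_zero, Finset.prod_const_one,
    funext_iff, Finset.mem_univ, true_imp_iff]

theorem pauliWord_zero : pauliWord (0 : Fin n → Fin 4) = 1 := by
  ext a b
  have : pauli 0 = 1 := rfl
  simp only [pauliWord, Matrix.of_apply, Pi.zero_apply, this, Matrix.one_apply,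
    Finset.prod_ite_zero, Finset.prod_const_one, funext_iff, Finset.mem_univ, true_imp_iff]

theorem isHermitian_pauliWord (s : Fin n → Fin 4) : (pauliWord s).IsHermitian := by
  ext a b
  simp only [pauliWord, Matrix.conjTranspose_apply, Matrix.of_apply, star_prod]
  refine Finset.prod_congr rfl fun q _ => ?_
  rw [← Matrix.conjTranspose_apply, conjTranspose_pauli]

theorem trace_pauliWord_mul (s t : Fin n → Fin 4) :
    (pauliWord s * pauliWord t).trace = if s = t then (2 : ℂ) ^ n else 0 := by
  simp only [Matrix.trace, Matrix.diag_apply, pauliWord_mul_apply]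
  have h := Finset.prod_univ_sum (fun _ : Fin n => (Finset.univ : Finset (Fin 2)))
    (fun q c => (pauli (s q) * pauli (t q)) c c)
  simp only [Fintype.piFinset_univ] at h
  rw [← h]
  have : ∀ q, ∑ c, (pauli (s q) * pauli (t q)) c c = if s q = t q then 2 else 0 := fun q =>
    trace_pauli_mul (s q) (t q)
  simp only [this, Finset.prod_ite_zero, funext_iff, Finset.mem_univ, true_imp_iff,
    Finset.prod_const, Finset.card_univ, Fintype.card_fin]

theorem trace_nonIdPauli_mul (i j : Fin (4 ^ n - 1)) :
    (nonIdPauli n i * nonIdPauli n j).trace = if i = j then (2 : ℂ) ^ n else 0 := by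
  rw [nonIdPauli, nonIdPauli, trace_pauliWord_mul]
  simp [Fin.ext_iff]

theorem trace_nonIdPauli (i : Fin (4 ^ n - 1)) : (nonIdPauli n i).trace = 0 := by
  have h := trace_pauliWord_mul
    (finFunctionFinEquiv.symm ⟨(i : ℕ) + 1, Nat.add_lt_of_lt_sub i.isLt⟩) (0 : Fin n → Fin 4)
  rw [pauliWord_zero, mul_one, if_neg] at h
  · exact h
  · rw [Equiv.symm_apply_eq, Fin.ext_iff]
    simp

/-- For `c = ±1` the operator `A = 1 + c P` is Hermitian and `A² = 2A` because `P² = 1`, so `A = Aᴴ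
A / 2`. -/
theorem posSemidef_one_add_smul_nonIdPauli (i : Fin (4 ^ n - 1)) {c : ℝ} (hc : c ^ 2 = 1) :
    (1 + (c : ℂ) • nonIdPauli n i).PosSemidef := by
  set P := nonIdPauli n i with hP
  have hPP : P * P = 1 := pauliWord_mul_self _
  have hH : (1 + (c : ℂ) • P)ᴴ = 1 + (c : ℂ) • P := by
    have : Pᴴ = P := isHermitian_pauliWord _
    simp [this]
  have hcc : (c : ℂ) * c = 1 := by
    rw [← Complex.ofReal_mul, ← sq, hc, Complex.ofReal_one]
  have h2 : (1 + (c : ℂ) • P) = (1 / 2 : ℂ) • ((1 + (c : ℂ) • P)ᴴ * (1 + (c : ℂ) • P)) := by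
    rw [hH]
    simp only [mul_add, add_mul, mul_one, one_mul, smul_mul_smul_comm, hPP, hcc, one_smul]
    module
  rw [h2]
  exact (Matrix.posSemidef_conjTranspose_mul_self _).smul (by
    rw [Complex.nonneg_iff]; norm_num)

variable {D : ℕ}

theorem le_four_pow_numQubits_sub_one (D : ℕ) : D ≤ 4 ^ numQubits D - 1 := by
  have := Nat.le_pow_clog (b := 4) (by norm_num) (D + 1)
  rw [numQubits]
  omega

theorem sum_pad {n : ℕ} (h : D ≤ 4 ^ n - 1) (r : Fin D → ℝ) : ∑ i, pad n r i = ∑ j, r j := by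
  symm
  refine Fintype.sum_of_injective (Fin.castLE h) (Fin.castLE_injective h) _ _ ?_ ?_
  · intro i hi
    rw [pad, dif_neg]
    intro hlt
    exact hi ⟨⟨i, hlt⟩, rfl⟩
  · intro j
    simp [pad]

theorem abs_pad (n : ℕ) (r : Fin D → ℝ) (i : Fin (4 ^ n - 1)) :
    |pad n r i| = pad n (fun j => |r j|) i := by
  unfold pad; split_ifs <;> simp

theorem pad_mul_pad (n : ℕ) (r s : Fin D → ℝ) (i : Fin (4 ^ n - 1)) :
    pad n r i * pad n s i = pad n (fun j => r j * s j) i := by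
  unfold pad; split_ifs <;> simp

variable {r s : Fin D → ℝ}

theorem isDensity_c2qe (hr : oneNorm r = 1) : IsDensity (c2qe r) := by
  constructor
  · refine Matrix.posSemidef_sum _ fun i _ => ?_
    -- The sign is `±1` only for nonzero coefficients; the remaining summands have weight zero.
    rcases eq_or_ne (pad (numQubits D) r i) 0 with h | h
    · simp [h, Matrix.PosSemidef.zero]
    · refine Matrix.PosSemidef.smul (Matrix.PosSemidef.smul
        (posSemidef_one_add_smul_nonIdPauli i ?_) ?_) ?_
      · rcases h.lt_or_gt with h | h <;> simp [h]
      · positivity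
      · exact Complex.zero_le_real.2 (abs_nonneg _)
  · have : ∀ i, ((|pad (numQubits D) r i| : ℝ) : ℂ) •
        ((1 / 2 ^ numQubits D : ℂ) •
        (1 + ((SignType.sign (pad (numQubits D) r i) : ℝ) : ℂ) • nonIdPauli (numQubits D) i)).trace
        = ((|pad (numQubits D) r i| : ℝ) : ℂ) := by
      intro i
      rw [Matrix.trace_smul, Matrix.trace_add, Matrix.trace_smul, trace_nonIdPauli,
        Matrix.trace_one]
      simp
    rw [c2qe, Matrix.trace_sum]
    simp_rw [Matrix.trace_smul _ (_ • _), this, abs_pad]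
    rw [← Complex.ofReal_sum, sum_pad (le_four_pow_numQubits_sub_one D)]
    rw [oneNorm] at hr
    simp [hr]

/-- The weights sum to 1 and `|t| sign t = t`, so the mixture is affine in `r`. -/
theorem c2qe_eq (hr : oneNorm r = 1) :
    c2qe r = (1 / 2 ^ numQubits D : ℂ) •
      (1 + ∑ i, (pad (numQubits D) r i : ℂ) • nonIdPauli (numQubits D) i) := by
  have h1 : ∑ i, ((|pad (numQubits D) r i| : ℝ) : ℂ) = 1 := by
    simp_rw [abs_pad]
    rw [← Complex.ofReal_sum, sum_pad (le_four_pow_numQubits_sub_one D)]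
    rw [oneNorm] at hr
    simp [hr]
  rw [c2qe]
  simp_rw [smul_comm _ (1 / 2 ^ numQubits D : ℂ)]
  rw [← Finset.smul_sum]
  simp_rw [smul_add, smul_smul]
  rw [← smul_add, Finset.sum_add_distrib, ← Finset.sum_smul, h1, one_smul]
  congr 2
  refine Finset.sum_congr rfl fun i _ => ?_
  rw [← Complex.ofReal_mul, abs_mul_sign]

/-- Non-identity words are traceless and mutually trace-orthogonal, so only the identity term and
the diagonal terms survive. -/
theorem two_pow_mul_trace_c2qe_mul (hr : oneNorm r = 1) (hs : oneNorm s = 1) :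
    2 ^ numQubits D * ((c2qe r * c2qe s).trace).re = 1 + ∑ j, r j * s j := by
  set n := numQubits D with hn
  have h2 : (2 : ℂ) ^ n ≠ 0 := by positivity
  have ht : (c2qe r * c2qe s).trace = ((1 / 2 ^ n * (1 + ∑ j, r j * s j) : ℝ) : ℂ) := by
    rw [c2qe_eq hr, c2qe_eq hs, smul_mul_smul_comm, Matrix.trace_smul, mul_add, add_mul, add_mul,
      one_mul, mul_one, one_mul, Matrix.trace_add, Matrix.trace_add, Matrix.trace_add,
      Matrix.trace_one, Matrix.trace_sum, Matrix.trace_sum, Finset.sum_mul_sum, Matrix.trace_sum]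
    simp_rw [Matrix.trace_sum, Matrix.trace_smul, smul_mul_smul_comm, Matrix.trace_smul,
      trace_nonIdPauli, trace_nonIdPauli_mul]
    rw [← sum_pad (le_four_pow_numQubits_sub_one D) (fun j => r j * s j)]
    simp_rw [← pad_mul_pad]
    simp only [smul_eq_mul, mul_zero, Finset.sum_const_zero, add_zero, mul_ite, Finset.sum_ite_eq,
      Finset.mem_univ, if_true]
    push_cast
    rw [← Finset.sum_mul, ← hn]
    simp only [Fintype.card_pi, Fintype.card_fin, Finset.prod_const, Finset.card_univ]
    push_cast
    field_simp
    ring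
  rw [ht, Complex.ofReal_re, ← hn]
  field_simp

end Pauli

/-! ### Random Fourier features and their quantum version -/

section Features

variable {d m : ℕ}

theorem sum_fin_two_mul_ite (f g : Fin m → ℝ) :
    ∑ j : Fin (2 * m), (if (j : ℕ) % 2 = 0 then f ⟨(j : ℕ) / 2, by omega⟩
      else g ⟨(j : ℕ) / 2, by omega⟩) = ∑ q, (f q + g q) := by
  rw [← Fintype.sum_equiv (finProdFinEquiv.trans (finCongr (mul_comm m 2)))
    (fun z : Fin m × Fin 2 => if z.2 = 0 then f z.1 else g z.1)]
  · rw [Fintype.sum_prod_type]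
    simp [Fin.sum_univ_two]
  · rintro ⟨q, c⟩
    have h1 : ((c : ℕ) + 2 * (q : ℕ)) / 2 = q := by omega
    have h2 : ((c : ℕ) + 2 * (q : ℕ)) % 2 = c := by omega
    simp only [Equiv.trans_apply, finProdFinEquiv_apply_val, finCongr_apply, Fin.val_cast, h1, h2,
      Fin.ext_iff, Fin.val_zero]

theorem inner_rff (hm : 0 < m) (ω : Fin m → Vec d) (x x' : Vec d) :
    inner ℝ (rff ω x) (rff ω x') = cosAverage ω (x - x') := by
  have hm' : (0 : ℝ) < m := Nat.cast_pos.2 hm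
  have hs : √(2 / ((2 * m : ℕ) : ℝ)) * √(2 / ((2 * m : ℕ) : ℝ)) = 1 / m := by
    rw [Real.mul_self_sqrt (by positivity)]
    push_cast
    field_simp
  have h := sum_fin_two_mul_ite
    (fun q => 1 / (m : ℝ) * (Real.cos (inner ℝ (ω q) x) * Real.cos (inner ℝ (ω q) x')))
    (fun q => 1 / (m : ℝ) * (Real.sin (inner ℝ (ω q) x) * Real.sin (inner ℝ (ω q) x')))
  rw [PiLp.inner_apply, cosAverage, Finset.sum_div]
  refine Eq.trans (Finset.sum_congr rfl fun j _ => ?_) (h.trans (Finset.sum_congr rfl fun q _ => ?_))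
  · rw [← hs]
    simp only [rff, RCLike.inner_apply, conj_trivial]
    split_ifs <;> ring
  · rw [inner_sub_right, Real.cos_sub]
    ring

/-- `⟨z(x), z(x)⟩ = 1` by `cos² + sin² = 1`, so `z(x)` never vanishes and its normalization is
legitimate. -/
theorem oneNorm_rff_pos (hm : 0 < m) (ω : Fin m → Vec d) (x : Vec d) :
    0 < oneNorm (rff ω x) := by
  have hm' : (0 : ℝ) < m := Nat.cast_pos.2 hm
  have h0 : 0 ≤ oneNorm (rff ω x) := Finset.sum_nonneg fun j _ => abs_nonneg _
  refine h0.lt_of_ne fun h => ?_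
  have hz : rff ω x = 0 := by
    ext j
    have := (Finset.sum_eq_zero_iff_of_nonneg fun j _ => abs_nonneg _).1 h.symm j (Finset.mem_univ j)
    simpa using this
  have h1 := inner_rff hm ω x x
  rw [hz, inner_zero_left, sub_self, cosAverage] at h1
  simp [hm'.ne'] at h1

theorem oneNorm_rff_div (hm : 0 < m) (ω : Fin m → Vec d) (x : Vec d) :
    oneNorm (fun j => rff ω x j / oneNorm (rff ω x)) = 1 := by
  have hg := oneNorm_rff_pos hm ω x
  rw [oneNorm]
  simp_rw [abs_div, abs_of_pos hg]
  rw [← Finset.sum_div]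
  exact div_self hg.ne'

theorem isDensity_qrff (hm : 0 < m) (ω : Fin m → Vec d) (x : Vec d) : IsDensity (qrff ω x) :=
  isDensity_c2qe (oneNorm_rff_div hm ω x)

theorem qrffKernel_eq_inner (hm : 0 < m) (ω : Fin m → Vec d) (x x' : Vec d) :
    qrffKernel ω x x' = inner ℝ (rff ω x) (rff ω x') := by
  have hg := oneNorm_rff_pos hm ω x
  have hg' := oneNorm_rff_pos hm ω x'
  rw [qrffKernel, eqk, qrff, qrff,
    two_pow_mul_trace_c2qe_mul (oneNorm_rff_div hm ω x) (oneNorm_rff_div hm ω x'),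
    add_sub_cancel_left, Finset.mul_sum, PiLp.inner_apply]
  refine Finset.sum_congr rfl fun j _ => ?_
  simp only [RCLike.inner_apply, conj_trivial]
  field_simp

/-- Minimality of `n` gives `4^(n-1) ≤ D`, and for `D ≥ 4` the missing factor 4 is again at most
`D`; hence `n log 2 ≤ log D`, with `log 2 > 1/2`. The value `D = 2` is checked directly. -/
theorem numQubits_le_two_mul_log (hm : 0 < m) :
    (numQubits (2 * m) : ℝ) ≤ 2 * Real.log ((2 * m : ℕ) : ℝ) := by
  have hlog2 := Real.log_two_gt_d9
  rcases Nat.lt_or_ge 1 m with h1 | h1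
  · set n := numQubits (2 * m) with hn
    rcases Nat.eq_zero_or_pos n with h0 | h0
    · rw [h0, Nat.cast_zero]
      exact mul_nonneg zero_le_two (Real.log_natCast_nonneg _)
    have hlt : 4 ^ (n - 1) < 2 * m + 1 := by
      rw [hn, numQubits]
      exact Nat.pow_pred_clog_lt_self (by norm_num) (by omega)
    have hle : 4 ^ (n - 1) ≤ 2 * m := by omega
    have hle' : ((4 : ℝ)) ^ (n - 1) ≤ ((2 * m : ℕ) : ℝ) := by exact_mod_cast hle
    have h2 := Real.log_le_log (by positivity) hle'
    have h4 : Real.log 4 = 2 * Real.log 2 := by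
      rw [show (4 : ℝ) = 2 ^ 2 by norm_num, Real.log_pow]; norm_num
    rw [Real.log_pow, h4, Nat.cast_sub h0, Nat.cast_one] at h2
    have h3 : Real.log 4 ≤ Real.log ((2 * m : ℕ) : ℝ) :=
      Real.log_le_log (by norm_num) (by exact_mod_cast (by omega : 4 ≤ 2 * m))
    rw [h4] at h3
    have hn1 : (1 : ℝ) ≤ n := by exact_mod_cast h0
    nlinarith
  · have : m = 1 := le_antisymm h1 hm
    subst this
    have : numQubits (2 * 1) = 1 := by
      rw [numQubits, Nat.clog_of_two_le (by norm_num) (by norm_num)]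
      simp
    rw [this]
    norm_num
    linarith

end Features

/-! ### The frequency measure and the choice of the constant -/

section Kernel

variable {d : ℕ} {k : Vec d → Vec d → ℝ}

theorem IsShiftInvariant.apply_eq (hk : IsShiftInvariant k) (x x' : Vec d) :
    k x x' = k (x - x') 0 := by
  have := hk (x - x') 0 x'
  simpa using this

theorem IsKernel.isPosSemidefFun (hk : IsKernel k) (hs : IsShiftInvariant k) :
    IsPosSemidefFun fun Δ => k Δ 0 where
  even x := by rw [hk.symm x 0, hs.apply_eq 0 x, zero_sub]
  psd n x a := by
    simp_rw [← hs.apply_eq]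
    exact hk.psd n x a

theorem existsUnique_isInverseFT (hk : IsKernel k) (hs : IsShiftInvariant k)
    (hc : Continuous (Function.uncurry k)) (h0 : k 0 0 = 1) :
    ∃! p : Measure (Vec d), IsInverseFT k p := by
  obtain ⟨μ, hμ⟩ := (hk.isPosSemidefFun hs).exists_charFun_eq
    (hc.comp (by fun_prop : Continuous fun Δ : Vec d => (Δ, (0 : Vec d)))) h0
  refine ⟨μ, ⟨inferInstance, hμ⟩, fun ν hν => ?_⟩
  have := hν.1
  exact Measure.ext_of_charFun (funext fun t => (hν.2 t).trans (hμ t).symm)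

/-- The choice of the constant: with `N = ⌈32 M / δ⌉` grid points per axis both error terms of the
uniform deviation bound are at most `δ / 2`. -/
theorem exists_const_grid_bound {δ : ℝ} (hδ : 0 < δ) (hδ1 : δ < 1) :
    ∃ C : ℝ, 0 < C ∧ ∀ (d m : ℕ) (ε Q : ℝ), 0 < d → 0 < ε →
      C * (d / ε ^ 2) * Real.log (max 2 Q) ≤ ((2 * m : ℕ) : ℝ) →
      ∃ N : ℕ, 0 < N ∧
        (N : ℝ) ^ d * (2 * Real.exp (-(m * ε ^ 2 / 8))) + 16 * Q / N ≤ δ := by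
  have hlog2 : 0 < Real.log 2 := Real.log_pos one_lt_two
  -- Chosen so that `2^(-K) = δ² / 132`, where `132 = 4 · 33` and `N ≤ 33 M / δ`.
  set K := Real.log (132 / δ ^ 2) / Real.log 2 with hK
  have hK0 : 0 < K := by
    refine div_pos (Real.log_pos ?_) hlog2
    rw [lt_div_iff₀ (by positivity)]
    nlinarith
  -- The factor 16 is the 8 of the Hoeffding exponent times 2 from `D = 2m`.
  refine ⟨16 * (1 + K), by positivity, fun d m ε Q hd hε hD => ?_⟩
  set M := max 2 Q with hM
  have hM2 : 2 ≤ M := le_max_left _ _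
  have hM0 : 0 < M := by linarith
  have hMδ : 1 ≤ M / δ := by rw [le_div_iff₀ hδ]; linarith
  have hN0 : 0 < ⌈32 * M / δ⌉₊ := Nat.ceil_pos.2 (by positivity)
  refine ⟨⌈32 * M / δ⌉₊, hN0, ?_⟩
  have hN1 := Nat.le_ceil (32 * M / δ)
  have hN2 := (Nat.ceil_lt_add_one (show 0 ≤ 32 * M / δ by positivity)).le
  set N : ℝ := (⌈32 * M / δ⌉₊ : ℝ) with hN
  have hNpos : 0 < N := by rw [hN]; exact_mod_cast hN0
  have hNle : N ≤ 33 * (M / δ) := by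
    have : 32 * M / δ = 32 * (M / δ) := by ring
    linarith
  have hgrid : 16 * Q / N ≤ δ / 2 := by
    rw [div_le_iff₀ hNpos]
    have h1 : 32 * M ≤ N * δ := by rwa [div_le_iff₀ hδ] at hN1
    have h2 : Q ≤ M := le_max_right _ _
    linarith
  have hexp : Real.exp (-(m * ε ^ 2 / 8)) ≤ Real.exp (-((1 + K) * Real.log M)) ^ d := by
    rw [← Real.exp_nat_mul]
    refine Real.exp_le_exp.2 ?_
    have h1 : 16 * (1 + K) * (d / ε ^ 2) * Real.log M * ε ^ 2 ≤ ((2 * m : ℕ) : ℝ) * ε ^ 2 :=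
      mul_le_mul_of_nonneg_right hD (by positivity)
    have h2 : 16 * (1 + K) * (d / ε ^ 2) * Real.log M * ε ^ 2
        = 16 * (d * ((1 + K) * Real.log M)) := by
      field_simp
    rw [h2] at h1
    push_cast at h1
    linarith
  -- In `M^(-(1 + K))` one power of `M` cancels that in `N`; since `M ≥ 2`, the other factor is at
  -- most `2^(-K)`.
  have hstep : N * Real.exp (-((1 + K) * Real.log M)) ≤ δ / 4 := by
    have h1 : Real.exp (-((1 + K) * Real.log M)) ≤ M⁻¹ * (δ ^ 2 / 132) := by
      rw [show -((1 + K) * Real.log M) = -Real.log M + -(K * Real.log M) by ring, Real.exp_add,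
        Real.exp_neg, Real.exp_log hM0]
      refine mul_le_mul_of_nonneg_left ?_ (by positivity)
      calc Real.exp (-(K * Real.log M)) ≤ Real.exp (-(K * Real.log 2)) := by
            refine Real.exp_le_exp.2 (neg_le_neg (mul_le_mul_of_nonneg_left ?_ hK0.le))
            exact Real.log_le_log (by norm_num) hM2
        _ = δ ^ 2 / 132 := by
            rw [hK, div_mul_cancel₀ _ hlog2.ne', Real.exp_neg, Real.exp_log (by positivity),
              inv_div]
    calc _ ≤ 33 * (M / δ) * (M⁻¹ * (δ ^ 2 / 132)) := by gcongr
      _ = δ / 4 := by field_simp; norm_num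
  -- The base is at most 1, so its `d`-th power does not exceed it when `d ≥ 1`.
  have hpow : (N * Real.exp (-((1 + K) * Real.log M))) ^ d ≤ δ / 4 :=
    (pow_le_of_le_one (by positivity) (by linarith) hd.ne').trans hstep
  have hmain : N ^ d * (2 * Real.exp (-(m * ε ^ 2 / 8))) ≤ δ / 2 := by
    calc _ ≤ N ^ d * (2 * Real.exp (-((1 + K) * Real.log M)) ^ d) := by gcongr
      _ = 2 * (N * Real.exp (-((1 + K) * Real.log M))) ^ d := by rw [mul_pow]; ring
      _ ≤ _ := by linarith
  linarith

end Kernel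

end QKernel

/-! ### The main result -/

open QKernel
theorem corollary1 (δ : ℝ) (hδ : 0 < δ) (hδ1 : δ < 1) :
    ∃ C : ℝ, 0 < C ∧
      ∀ (d : ℕ) (R B ε : ℝ) (X : Set (Vec d)) (k : Vec d → Vec d → ℝ),
        0 < ε →
        IsCompact X →
        (∀ x ∈ X, ∀ i, x i ∈ Set.Icc (-R) R) →
        IsKernel k →
        IsShiftInvariant k →
        Continuous (Function.uncurry k) →
        k 0 0 = 1 →
        (∀ i : Fin d, ∃ b : ℝ, HasSecondPartialAtZero k i b ∧ |b| ≤ B) →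
        (∃! p : MeasureTheory.Measure (Vec d), IsInverseFT k p) ∧
        ∀ p : MeasureTheory.Measure (Vec d), IsInverseFT k p →
          ∀ m : ℕ, 0 < m →
            C * (d / ε ^ 2) * Real.log (max 2 (R * d * √B / ε)) ≤ ((2 * m : ℕ) : ℝ) →
            MeasureTheory.Measure.pi (fun _ : Fin m => p)
                {ω | ¬ (IsApproxOn X (fun x x' => inner ℝ (rff ω x) (rff ω x')) k ε ∧
                        IsApproxOn X (qrffKernel ω) k ε)} ≤ ENNReal.ofReal δ ∧
            (∀ (ω : Fin m → Vec d) (x : Vec d), IsDensity (qrff ω x)) ∧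
            (numQubits (2 * m) : ℝ) ≤ 2 * Real.log ((2 * m : ℕ) : ℝ) := by
  obtain ⟨C, hC, hbound⟩ := exists_const_grid_bound hδ hδ1
  refine ⟨C, hC, fun d R B ε X k hε _ hX hk hs hc h0 hder =>
    ⟨existsUnique_isInverseFT hk hs hc h0, fun p hp m hm hD =>
      ⟨?_, fun ω x => isDensity_qrff hm ω x, numQubits_le_two_mul_log hm⟩⟩⟩
  have := hp.1
  have hmean : ∀ Δ, cosMean p Δ = k Δ 0 := hp.integral_cos
  -- The quantum kernel equals the inner product identically, so failure of either approximation is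
  -- one and the same event.
  have hbad : {ω : Fin m → Vec d | ¬ (IsApproxOn X (fun x x' => inner ℝ (rff ω x) (rff ω x')) k ε ∧
      IsApproxOn X (qrffKernel ω) k ε)} ⊆
      {ω | ∃ x ∈ X, ∃ x' ∈ X, ε ≤ |cosAverage ω (x - x') - cosMean p (x - x')|} := by
    intro ω hω
    by_contra hcon
    refine hω ?_
    simp only [Set.mem_ofPred_eq, not_exists, not_and, not_le] at hcon
    have hin : IsApproxOn X (fun x x' => inner ℝ (rff ω x) (rff ω x')) k ε := by
      intro x hx x' hx'
      beta_reduce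
      rw [inner_rff hm, hs.apply_eq x x', ← hmean]
      exact hcon x hx x' hx'
    refine ⟨hin, fun x hx x' hx' => ?_⟩
    rw [qrffKernel_eq_inner hm]
    exact hin x hx x' hx'
  refine (measure_mono hbad).trans ?_
  have hm' : (m : ℝ) ≠ 0 := Nat.cast_ne_zero.2 hm.ne'
  -- For `d = 0` the lower bound on `D` is vacuous, but the average and the kernel are both
  -- identically 1 and nothing can fail.
  rcases Nat.eq_zero_or_pos d with rfl | hd
  · refine le_of_eq_of_le ?_ zero_le
    convert measure_empty (μ := Measure.pi fun _ : Fin m => p)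
    refine Set.eq_empty_iff_forall_notMem.2 fun ω ⟨x, _, x', _, hω⟩ => ?_
    rw [Subsingleton.elim (x - x') 0, hmean, h0, cosAverage] at hω
    simp [hm'] at hω
    linarith
  -- A point of `X` is what guarantees `R ≥ 0`.
  rcases X.eq_empty_or_nonempty with rfl | ⟨y, hy⟩
  · simp
  have hR : 0 ≤ R := by
    have := hX y hy ⟨0, hd⟩
    linarith [this.1, this.2]
  choose b hb hbB using hder
  have hmom := fun i => hp.integrable_abs_and_integral_abs_le (hb i) (hbB i)
  obtain ⟨N, hN, hNδ⟩ := hbound d m ε (R * d * √B / ε) hd hε hD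
  refine (measure_mono ?_).trans ((measure_exists_le_abs_cosAverage_sub_cosMean (p := p) hm hR
    (Real.sqrt_nonneg B) hε (fun i => (hmom i).1) (fun i => (hmom i).2) hN).trans
      (ENNReal.ofReal_le_ofReal hNδ))
  rintro ω ⟨x, hx, x', hx', hdev⟩
  refine ⟨x - x', fun i => ?_, hdev⟩
  have h1 := hX x hx i
  have h2 := hX x' hx' i
  rw [PiLp.sub_apply, abs_le]
  constructor <;> linarith [h1.1, h1.2, h2.1, h2.2]
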